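/- Let $I$ be a set of positive real numbers having $0$ as a limit point, let $S$ be a finite set, and let $p=(p_\epsilon)_{\epsilon\in I}$ be a perturbation on $S$, that is, a family of transition matrices of Markov chains with state space $S$. A state $x$ is *stable* for a perturbation if there is a family $(\mu_\epsilon)_{\epsilon\in I}$, with $\mu_\epsilon$ a stationary distribution of the $\epsilon$-th chain, such that $\liminf_{\epsilon\to 0}\mu_\epsilon(x)>0$ (the limit being taken along $I$). For $f,g:I\to[0,1]$ write $f\precsim g$ if there are $b,\epsilon_0>0$ such that $f(\epsilon)\le b\,g(\epsilon)$ for all $\epsilon\in I$ with $\epsilon<\epsilon_0$; write $p(x,y)$ for the map $\epsilon\mapsto p_\epsilon(x,y)$. The *essential graph* of $p$ has vertex set $S$ and an arc $(x,y)$ whenever $x\neq y$ and $p(z,t)\precsim p(x,y)$ for all $z,t\in S$. Its *essential classes* are its sink strongly connected components (those that no arc leaves); let $T$ be the set of *transient* states, i.e. of the states that belong to no essential class. Assume that 1. the multiplicative closure of the maps $p(x,y)$ with $x\neq y$ is totally preordered by $\precsim$ (that is, $f\precsim g$ or $g\precsim f$ for all $f,g$ in it); 2. every essential class of $p$ is a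 singleton. The *transient deletion* $\delta(p)$ is the perturbation on $S\setminus T$ given, for distinct $x,y\in S\setminus T$ and $\epsilon\in I$, by $$\delta(p)_\epsilon(x,y)=\mathbb{P}^x_\epsilon\big(X_{\tau^+}=y\big),\qquad \tau^+=\inf\{n>0: X_n\in S\setminus T\},$$ the probability that the chain $p_\epsilon$ started at $x$ is at $y$ the first positive time at which it is in $S\setminus T$ (such a time not existing counts as failure), with diagonal entries $\delta(p)_\epsilon(x,x)=1-\sum_{y\neq x}\delta(p)_\epsilon(x,y)$. Then $p$ and $\delta(p)$ have the same stable states: a state $x\in S$ is stable for $p$ if and only if $x\in S\setminus T$ and $x$ is stable for $\delta(p)$. -/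

import Mathlib

open Filter Topology MeasureTheory ProbabilityTheory

namespace PerturbedMC

/-- `I` is a set of positive reals that has `0` as a limit point. -/
def IsNoiseSet (I : Set ℝ) : Prop :=
  (∀ ε ∈ I, 0 < ε) ∧ AccPt (0 : ℝ) (𝓟 I)

/-! ### Finite Markov chains -/

/-- Transition matrices of discrete-time Markov chains on a finite state space. -/
structure Chain (S : Type*) [Fintype S] where
  prob : S → S → ℝ
  nonneg : ∀ x y, 0 ≤ prob x y
  sum_eq_one : ∀ x, ∑ y, prob x y = 1

/-- The event `X_{τ⁺} = y`, where `τ⁺ = inf {n > 0 : X_n ∈ A}`: the trajectory `ω` visits `A` at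
a positive time, and is at `y` the first time it does so. -/
def firstEntryEvent {S : Type*} (A : Set S) (y : S) : Set (ℕ → S) :=
  {ω | ∃ n : ℕ, 0 < n ∧ ω n ∈ A ∧ (∀ k : ℕ, 0 < k → k < n → ω k ∉ A) ∧ ω n = y}

theorem measurableSet_firstEntryEvent {S : Type*} [MeasurableSpace S] [DiscreteMeasurableSpace S]
    (A : Set S) (y : S) : MeasurableSet (firstEntryEvent A y) := by
  have h : firstEntryEvent A y = ⋃ n : ℕ, ⋃ _ : 0 < n,
      ((fun ω : ℕ → S => ω n) ⁻¹' (A ∩ {y}) ∩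
        ⋂ k : ℕ, ⋂ _ : 0 < k, ⋂ _ : k < n, (fun ω : ℕ → S => ω k) ⁻¹' Aᶜ) := by
    ext ω
    simp only [firstEntryEvent, Set.mem_ofPred_eq, Set.mem_iUnion, Set.mem_inter_iff,
      Set.mem_preimage, Set.mem_iInter, Set.mem_compl_iff, Set.mem_singleton_iff, exists_prop]
    exact exists_congr fun n => by tauto
  rw [h]
  refine MeasurableSet.iUnion fun n => MeasurableSet.iUnion fun _ => MeasurableSet.inter ?_ ?_
  · exact measurable_pi_apply n (MeasurableSet.of_discrete)
  · exact MeasurableSet.iInter fun k => MeasurableSet.iInter fun _ => MeasurableSet.iInter fun _ =>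
      measurable_pi_apply k (MeasurableSet.of_discrete)

theorem firstEntryEvent_disjoint {S : Type*} (A : Set S) {y z : S} (hyz : y ≠ z) :
    Disjoint (firstEntryEvent A y) (firstEntryEvent A z) := by
  rw [Set.disjoint_left]
  rintro ω ⟨n, hn, hnA, hn', rfl⟩ ⟨m, hm, hmA, hm', hmz⟩
  rcases lt_trichotomy n m with h | h | h
  · exact hm' n hn h hnA
  · subst h; exact hyz hmz
  · exact hn' m hm h hmA

namespace Chain

variable {S : Type*} [Fintype S]

/-- `μ` is a stationary distribution of the chain: a probability vector with `μ P = μ`. -/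
def IsStationary (P : Chain S) (μ : S → ℝ) : Prop :=
  μ ∈ stdSimplex ℝ S ∧ ∀ y, ∑ x, μ x * P.prob x y = μ y

section Law

variable [MeasurableSpace S] [DiscreteMeasurableSpace S]

/-- The law of one step of the chain from the state `x`. -/
noncomputable def stepMeasure (P : Chain S) (x : S) : Measure S :=
  ∑ y, ENNReal.ofReal (P.prob x y) • Measure.dirac y

instance (P : Chain S) (x : S) : IsProbabilityMeasure (P.stepMeasure x) where
  measure_univ := by
    simp only [stepMeasure, Measure.coe_finsetSum, Measure.coe_smul, Finset.sum_apply,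
      Pi.smul_apply, measure_univ, smul_eq_mul, mul_one]
    rw [← ENNReal.ofReal_sum_of_nonneg (fun y _ => P.nonneg x y), P.sum_eq_one x,
      ENNReal.ofReal_one]

/-- The step from time `n` to time `n + 1`, which depends on the past only through the state at
time `n`. -/
noncomputable def stepKernel (P : Chain S) (n : ℕ) :
    Kernel ((i : Finset.Iic n) → (fun _ : ℕ => S) i) S where
  toFun h := P.stepMeasure (h ⟨n, Finset.mem_Iic.2 le_rfl⟩)
  measurable' := (Measurable.of_discrete (f := P.stepMeasure)).comp
    (measurable_pi_apply (X := fun _ : Finset.Iic n => S) ⟨n, Finset.mem_Iic.2 le_rfl⟩)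

instance (P : Chain S) (n : ℕ) : IsMarkovKernel (P.stepKernel n) where
  isProbabilityMeasure h :=
    inferInstanceAs (IsProbabilityMeasure (P.stepMeasure (h ⟨n, Finset.mem_Iic.2 le_rfl⟩)))

/-- The law `ℙ^x` of the trajectory `(X₀, X₁, …)` of the chain started at `X₀ = x`. -/
noncomputable def law (P : Chain S) (x : S) : Measure (ℕ → S) :=
  Kernel.traj (X := fun _ : ℕ => S) P.stepKernel 0 (fun _ => x)

instance (P : Chain S) (x : S) : IsProbabilityMeasure (P.law x) :=
  inferInstanceAs (IsProbabilityMeasure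
    (Kernel.traj (X := fun _ : ℕ => S) P.stepKernel 0 (fun _ => x)))

end Law

/-- The probability `ℙ^x(X_{τ⁺_A} = y)`. -/
noncomputable def firstEntryProb (P : Chain S) (A : Set S) (x y : S) : ℝ :=
  letI : MeasurableSpace S := ⊤
  haveI : DiscreteMeasurableSpace S := ⟨fun _ => trivial⟩
  (P.law x).real (firstEntryEvent A y)

theorem firstEntryProb_nonneg (P : Chain S) (A : Set S) (x y : S) :
    0 ≤ P.firstEntryProb A x y := by
  unfold firstEntryProb
  exact measureReal_nonneg

theorem sum_firstEntryProb_le_one (P : Chain S) (A : Set S) (x : S) (s : Finset S) :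
    ∑ y ∈ s, P.firstEntryProb A x y ≤ 1 := by
  let _ : MeasurableSpace S := ⊤
  have _ : DiscreteMeasurableSpace S := ⟨fun _ => trivial⟩
  have h := measureReal_biUnion_finset (μ := P.law x) (s := s) (f := fun y => firstEntryEvent A y)
    (fun y _ z _ hyz => firstEntryEvent_disjoint A hyz)
    (fun y _ => measurableSet_firstEntryEvent A y)
  have h' : ∑ y ∈ s, P.firstEntryProb A x y = ∑ y ∈ s, (P.law x).real (firstEntryEvent A y) := rfl
  rw [h', ← h]
  exact measureReal_le_one

open scoped Classical in
/-- The chain induced on a set `A` of states: for distinct `x, y ∈ A` its transition probability is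
`ℙ^x(X_{τ⁺_A} = y)`, and the diagonal entries complete the rows to sum `1`. -/
noncomputable def induced (P : Chain S) (A : Set S) [Fintype A] : Chain A where
  prob x y :=
    if x = y then 1 - ∑ z ∈ Finset.univ.erase x, P.firstEntryProb A x z
    else P.firstEntryProb A x y
  nonneg x y := by
    split_ifs
    · have h := P.sum_firstEntryProb_le_one A x
        ((Finset.univ.erase x).map (Function.Embedding.subtype (· ∈ A)))
      rw [Finset.sum_map] at h
      exact sub_nonneg.2 h
    · exact P.firstEntryProb_nonneg A x y
  sum_eq_one x := by
    rw [← Finset.add_sum_erase _ _ (Finset.mem_univ x), if_pos rfl]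
    rw [Finset.sum_congr rfl (g := fun z : A => P.firstEntryProb A x z)
      (fun z hz => if_neg (Finset.ne_of_mem_erase hz).symm)]
    ring

end Chain

/-! ### Perturbations -/

/-- A perturbation: a family, indexed by the noise level `ε ∈ I`, of Markov chains that share the
same finite state space. -/
abbrev Perturbation (I : Set ℝ) (S : Type*) [Fintype S] := I → Chain S

/-- The order `f ≾ g`: there are positive `b` and `ε` with `f ε' ≤ b * g ε'` for all `ε' < ε`. -/
def Preceq {I : Set ℝ} (f g : I → ℝ) : Prop :=
  ∃ b : ℝ, 0 < b ∧ ∃ ε : ℝ, 0 < ε ∧ ∀ ε' : I, (ε' : ℝ) < ε → f ε' ≤ b * g ε'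

namespace Perturbation

variable {I : Set ℝ} {S : Type*} [Fintype S]

/-- The map `ε ↦ p_ε(x, y)`. -/
def map (p : Perturbation I S) (x y : S) : I → ℝ := fun ε => (p ε).prob x y

/-- The multiplicative closure of the maps `ε ↦ p_ε(x, y)` with `x ≠ y` is totally preordered by
`≾` (which is always reflexive on nonnegative maps, and transitive). -/
def TotallyPreordered (p : Perturbation I S) : Prop :=
  ∀ f ∈ Subsemigroup.closure {f : I → ℝ | ∃ x y : S, x ≠ y ∧ f = p.map x y},
    ∀ g ∈ Subsemigroup.closure {f : I → ℝ | ∃ x y : S, x ≠ y ∧ f = p.map x y},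
      Preceq f g ∨ Preceq g f

/-- The state `x` is stochastically stable: `liminf_{ε → 0} μ_ε(x) > 0` for some family of
stationary distributions `μ_ε`. The limit is taken over `ε ∈ I`. -/
def IsStable (p : Perturbation I S) (x : S) : Prop :=
  ∃ μ : I → S → ℝ, (∀ ε, (p ε).IsStationary (μ ε)) ∧
    0 < liminf (fun ε : I => μ ε x) (comap ((↑) : I → ℝ) (𝓝 0))

/-- The set of stable states. -/
def stableStates (p : Perturbation I S) : Set S := {x | p.IsStable x}

/-- The arcs of the essential graph. -/
def EssArc (p : Perturbation I S) (x y : S) : Prop :=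
  x ≠ y ∧ ∀ z t : S, Preceq (p.map z t) (p.map x y)

/-- There is a (possibly empty) path from `x` to `y` in the essential graph. -/
def EssReach (p : Perturbation I S) : S → S → Prop := Relation.ReflTransGen p.EssArc

/-- `E` is a strongly connected component of the essential graph. -/
def IsSCC (p : Perturbation I S) (E : Set S) : Prop :=
  ∃ x : S, E = {y | p.EssReach x y ∧ p.EssReach y x}

/-- The essential classes: the sink (bottom) strongly connected components of the essential
graph, i.e. those that no arc leaves. -/
def IsEssentialClass (p : Perturbation I S) (E : Set S) : Prop :=
  p.IsSCC E ∧ ∀ x ∈ E, ∀ y, p.EssArc x y → y ∈ E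

/-- Every essential class is a singleton. -/
def SingletonEssentialClasses (p : Perturbation I S) : Prop :=
  ∀ E : Set S, p.IsEssentialClass E → ∃ x, E = {x}

/-- The set `T` of the transient states, i.e. the states that are in no essential class. -/
def transientStates (p : Perturbation I S) : Set S :=
  {x | ¬ ∃ E : Set S, p.IsEssentialClass E ∧ x ∈ E}

/-- The finite set `S \ T` of the non-transient states. -/
abbrev EssentialStates (p : Perturbation I S) : Type _ := ↥(p.transientStatesᶜ)

noncomputable instance (p : Perturbation I S) : Fintype p.EssentialStates := Fintype.ofFinite _

/-- The transient deletion `δ(p)`, a perturbation on `S \ T`, where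
`δ(p)(x, y) = ℙ^x(X_{τ⁺_{S \ T}} = y)` for distinct `x, y` (the diagonal completes the rows). -/
noncomputable def transientDeletion (p : Perturbation I S) : Perturbation I p.EssentialStates :=
  fun ε => (p ε).induced p.transientStatesᶜ

end Perturbation

end PerturbedMC

/-! Put `A = S \ T`. The essential graph does not depend on `ε`, its arcs have probability bounded
below as `ε → 0`, and every state reaches `A` along them. This gives one bounded Lyapunov function
`V ≤ M`, zero on `A`, that drops in mean by at least `1` per step from outside `A`, for all small
`ε` (`exists_isDrift`).

Such a `V` makes the Green function `G` of the chain stopped at `A` finite. On `A` it is the matrix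
of the induced chain, and every stationary `μ` satisfies `μ y = ∑ a ∈ A, μ a * G a y`. Restriction
to `A` and this extension formula therefore exchange the stationary distributions of `p_ε` and
`δ(p)_ε` up to normalisation. As `A` carries mass at least `1 / (1 + M)`, uniform lower bounds at
states of `A` survive both passages (`isStable_transientDeletion_iff`).

It remains to see that a transient state is not stable. Its mass is at most `M` times the total
probability of the arcs leaving `A`, and by comparability a single arc dominates that sum. Mass
bounded below would make this arc essential, but no essential arc leaves a singleton essential class
(`IsStable.notMem_transientStates`). -/

namespace PerturbedMC

/-! ### Law of the first entrance through taboo probabilities -/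

/-- The trajectory avoids `A` at the times `1, …, n` and is at `y` at time `n + 1`. -/
def tabooEvent {S : Type*} (A : Set S) (n : ℕ) (y : S) : Set (ℕ → S) :=
  {ω | (∀ k, 0 < k → k ≤ n → ω k ∉ A) ∧ ω (n + 1) = y}

theorem measurableSet_tabooEvent {S : Type*} [MeasurableSpace S] [DiscreteMeasurableSpace S]
    (A : Set S) (n : ℕ) (y : S) : MeasurableSet (tabooEvent A n y) := by
  have h : tabooEvent A n y = (⋂ k : ℕ, ⋂ _ : 0 < k, ⋂ _ : k ≤ n,
      (fun ω : ℕ → S => ω k) ⁻¹' Aᶜ) ∩ (fun ω : ℕ → S => ω (n + 1)) ⁻¹' {y} := by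
    ext ω
    simp [tabooEvent]
  rw [h]
  exact (MeasurableSet.iInter fun k => MeasurableSet.iInter fun _ => MeasurableSet.iInter fun _ =>
    measurable_pi_apply k (MeasurableSet.of_discrete)).inter
      (measurable_pi_apply (n + 1) (MeasurableSet.of_discrete))

theorem firstEntryEvent_eq_iUnion {S : Type*} {A : Set S} {y : S} (hy : y ∈ A) :
    firstEntryEvent A y = ⋃ n, tabooEvent A n y := by
  ext ω
  simp only [firstEntryEvent, tabooEvent, Set.mem_ofPred_eq, Set.mem_iUnion]
  constructor
  · rintro ⟨n, hn, -, h, h'⟩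
    obtain ⟨m, rfl⟩ := Nat.exists_eq_succ_of_ne_zero hn.ne'
    exact ⟨m, fun k hk hkm => h k hk (Nat.lt_succ_of_le hkm), h'⟩
  · rintro ⟨n, h, h'⟩
    exact ⟨n + 1, n.succ_pos, h' ▸ hy, fun k hk hkn => h k hk (Nat.le_of_lt_succ hkn), h'⟩

theorem pairwise_disjoint_tabooEvent {S : Type*} {A : Set S} {y : S} (hy : y ∈ A) :
    Pairwise (Function.onFun Disjoint fun n => tabooEvent A n y) := by
  intro n m hnm
  rw [Function.onFun, Set.disjoint_left]
  rintro ω ⟨h, h'⟩ ⟨k, k'⟩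
  rcases hnm.lt_or_gt with hlt | hlt
  · exact k (n + 1) n.succ_pos hlt (h' ▸ hy)
  · exact h (m + 1) m.succ_pos hlt (k' ▸ hy)

theorem tabooEvent_succ {S : Type*} [Fintype S] (A : Set S) [DecidablePred (· ∈ A)]
    (n : ℕ) (y : S) :
    tabooEvent A (n + 1) y =
      ⋃ z ∈ Finset.univ.filter (· ∉ A), tabooEvent A n z ∩ {ω | ω (n + 2) = y} := by
  ext ω
  simp only [tabooEvent, Finset.mem_filter, Finset.mem_univ, true_and, Set.mem_iUnion,
    Set.mem_inter_iff, Set.mem_ofPred_eq, exists_prop]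
  constructor
  · rintro ⟨h, h'⟩
    exact ⟨ω (n + 1), h _ n.succ_pos le_rfl, ⟨fun k hk hkn => h k hk (hkn.trans n.le_succ), rfl⟩, h'⟩
  · rintro ⟨z, hz, ⟨h, rfl⟩, h'⟩
    refine ⟨fun k hk hkn => ?_, h'⟩
    rcases hkn.lt_or_eq with hlt | rfl
    · exact h k hk (Nat.le_of_lt_succ hlt)
    · exact hz

namespace Chain

variable {S : Type*} [Fintype S]

open scoped Classical in
/-- The probability that the chain started at `x` avoids `A` at the times `1, …, n` and is at `y`
at time `n + 1`. -/
noncomputable def tabooProb (P : Chain S) (A : Set S) : ℕ → S → S → ℝ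
  | 0, x, y => P.prob x y
  | n + 1, x, y => ∑ z with z ∉ A, P.tabooProb A n x z * P.prob z y

theorem tabooProb_nonneg (P : Chain S) (A : Set S) (n : ℕ) (x y : S) :
    0 ≤ P.tabooProb A n x y := by
  induction n generalizing y with
  | zero => exact P.nonneg x y
  | succ n ih => exact Finset.sum_nonneg fun z _ => mul_nonneg (ih z) (P.nonneg z y)

section Law

variable [MeasurableSpace S] [DiscreteMeasurableSpace S]

theorem stepMeasure_singleton (P : Chain S) (x y : S) :
    P.stepMeasure x {y} = ENNReal.ofReal (P.prob x y) := by
  classical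
  simp [stepMeasure, Measure.dirac_apply', Set.indicator_apply]

theorem law_map_one (P : Chain S) (x : S) :
    (P.law x).map (fun ω => ω 1) = P.stepMeasure x := by
  have h := Kernel.map_traj_succ_self (X := fun _ : ℕ => S) (κ := P.stepKernel) (a := 0)
  have h' := congrArg (fun η => η (fun _ => x)) h
  rwa [Kernel.map_apply _ (by fun_prop)] at h'

/-- Markov property: the path up to time `n` and the next state have as joint law the composition
product with the step kernel, which is constant on `B` because `B` fixes the state at time `n`. -/
theorem law_inter_next (P : Chain S) (x : S) (n : ℕ) {B : Set ((i : Finset.Iic n) → S)}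
    (hB : MeasurableSet B) {z : S} (hBz : ∀ h ∈ B, h ⟨n, Finset.mem_Iic.2 le_rfl⟩ = z) (y : S) :
    P.law x (Preorder.frestrictLe (π := fun _ => S) n ⁻¹' B ∩ {ω | ω (n + 1) = y}) =
      P.law x (Preorder.frestrictLe (π := fun _ => S) n ⁻¹' B) * ENNReal.ofReal (P.prob z y) := by
  have h := Kernel.partialTraj_compProd_eq_map_traj (X := fun _ : ℕ => S) (κ := P.stepKernel)
    (Nat.zero_le n) (x₀ := fun _ => x)
  have h' := congrArg (fun μ => μ (B ×ˢ {y})) h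
  have hpre : (fun ω : ℕ → S => (Preorder.frestrictLe (π := fun _ => S) n ω, ω (n + 1))) ⁻¹' (B ×ˢ {y})
    = Preorder.frestrictLe (π := fun _ => S) n ⁻¹' B ∩ {ω | ω (n + 1) = y} := by
    ext; simp
  have hm : MeasurableSet (B ×ˢ ({y} : Set S)) := hB.prod (MeasurableSet.of_discrete)
  rw [Measure.map_apply (by fun_prop) hm, hpre, Measure.compProd_apply_prod hB
    (MeasurableSet.of_discrete), setLIntegral_congr_fun hB
    (g := fun _ => ENNReal.ofReal (P.prob z y))] at h'
  · rw [setLIntegral_const, ← Kernel.traj_map_frestrictLe_apply, Measure.map_apply (by fun_prop) hB,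
      mul_comm] at h'
    exact h'.symm
  · intro a ha
    rw [← hBz a ha]
    exact P.stepMeasure_singleton _ y

theorem law_tabooEvent (P : Chain S) (A : Set S) (n : ℕ) (x y : S) :
    P.law x (tabooEvent A n y) = ENNReal.ofReal (P.tabooProb A n x y) := by
  classical
  induction n generalizing y with
  | zero =>
    rw [tabooProb, ← P.stepMeasure_singleton, ← P.law_map_one,
      Measure.map_apply (by fun_prop) (MeasurableSet.of_discrete)]
    congr 1
    ext ω
    simp only [tabooEvent, Set.mem_ofPred_eq, Set.mem_preimage, Set.mem_singleton_iff, zero_add]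
    exact ⟨fun h => h.2, fun h => ⟨fun k hk hk' => by omega, h⟩⟩
  | succ n ih =>
    rw [tabooEvent_succ, measure_biUnion_finset, tabooProb, ENNReal.ofReal_sum_of_nonneg]
    · refine Finset.sum_congr (by congr) fun z _ => ?_
      rw [ENNReal.ofReal_mul (P.tabooProb_nonneg A n x z), ← ih]
      let B : Set ((i : Finset.Iic (n + 1)) → S) :=
        {h | (∀ k (hk : k ≤ n), 0 < k → h ⟨k, Finset.mem_Iic.2 (hk.trans n.le_succ)⟩ ∉ A) ∧
          h ⟨n + 1, Finset.mem_Iic.2 le_rfl⟩ = z}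
      have hB : tabooEvent A n z = Preorder.frestrictLe (π := fun _ => S) (n + 1) ⁻¹' B := by
        ext ω
        simp only [tabooEvent, B, Set.mem_ofPred_eq, Set.mem_preimage, Preorder.frestrictLe_apply]
        exact and_congr_left fun _ => forall_congr' fun k => forall_comm
      rw [hB]
      exact P.law_inter_next x (n + 1) (Set.toFinite B).measurableSet (fun h hh => hh.2) y
    · exact fun z _ => mul_nonneg (P.tabooProb_nonneg A n x z) (P.nonneg z y)
    · intro z _ z' _ hzz
      rw [Function.onFun, Set.disjoint_left]
      rintro ω ⟨⟨-, h⟩, -⟩ ⟨⟨-, h'⟩, -⟩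
      exact hzz (h.symm.trans h')
    · have hy : MeasurableSet ((fun ω : ℕ → S => ω (n + 2)) ⁻¹' {y}) :=
        measurable_pi_apply (n + 2) (MeasurableSet.of_discrete)
      exact fun z _ => (measurableSet_tabooEvent A n z).inter hy

end Law

theorem firstEntryProb_eq_tsum (P : Chain S) (A : Set S) (x : S) {y : S} (hy : y ∈ A) :
    P.firstEntryProb A x y = ∑' n, P.tabooProb A n x y := by
  let _ : MeasurableSpace S := ⊤
  have _ : DiscreteMeasurableSpace S := ⟨fun _ => trivial⟩
  change ((P.law x) (firstEntryEvent A y)).toReal = _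
  rw [firstEntryEvent_eq_iUnion hy, measure_iUnion (pairwise_disjoint_tabooEvent hy)
    (fun n => measurableSet_tabooEvent A n y), ENNReal.tsum_toReal_eq (fun n => measure_ne_top _ _)]
  simp_rw [law_tabooEvent, ENNReal.toReal_ofReal (P.tabooProb_nonneg A _ x y)]

end Chain
-- Stationary distributions, drift and the Green function
open scoped Classical in
/-- The arcs that leave `A`. -/
noncomputable def exitArcs {S : Type*} [Fintype S] (A : Set S) [Fintype A] : Finset (A × S) :=
  Finset.univ ×ˢ Finset.univ.filter (· ∉ A)

theorem mem_exitArcs {S : Type*} [Fintype S] {A : Set S} [Fintype A] {i : A × S} :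
    i ∈ exitArcs A ↔ i.2 ∉ A := by
  simp [exitArcs]

namespace Chain

variable {S : Type*} [Fintype S]

/-- A finite chain on a nonempty state space has a stationary distribution. -/
theorem exists_isStationary [Nonempty S] (P : Chain S) : ∃ μ, P.IsStationary μ := by
  classical
  let M : Matrix S S ℝ := 1 - Matrix.of P.prob
  -- Rows sum to `1`, so `1 - P` kills the constants and hence also has a nonzero left null vector
  -- `w`.
  have hdet : M.det = 0 := by
    refine Matrix.exists_mulVec_eq_zero_iff.1 ⟨fun _ => 1, ?_, ?_⟩
    · exact fun h => one_ne_zero (congrFun h (Classical.arbitrary S))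
    · ext x
      rw [Matrix.sub_mulVec, Matrix.one_mulVec]
      simp [Matrix.mulVec, dotProduct, P.sum_eq_one]
  obtain ⟨w, hw0, hw⟩ := Matrix.exists_vecMul_eq_zero_iff.2 hdet
  have hw' : ∀ y, ∑ x, w x * P.prob x y = w y := fun y => by
    have h := congrFun hw y
    simp only [M, Matrix.vecMul_sub, Matrix.vecMul_one, Pi.sub_apply, Pi.zero_apply] at h
    simpa [Matrix.vecMul, dotProduct] using (sub_eq_zero.1 h).symm
  have hle : ∀ y ∈ Finset.univ, |w y| ≤ ∑ x, |w x| * P.prob x y := fun y _ => by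
    rw [← hw' y]
    refine (Finset.abs_sum_le_sum_abs _ _).trans (Finset.sum_le_sum fun x _ => ?_)
    rw [abs_mul, abs_of_nonneg (P.nonneg x y)]
  have hsum : ∑ y, |w y| = ∑ y, ∑ x, |w x| * P.prob x y := by
    rw [Finset.sum_comm]
    simp_rw [← Finset.mul_sum, P.sum_eq_one, mul_one]
  -- `|w| ≤ |w| P` entrywise with equal totals, so `|w|` is itself invariant.
  have heq := (Finset.sum_eq_sum_iff_of_le hle).1 hsum
  obtain ⟨x₀, hx₀⟩ := Function.ne_iff.1 hw0
  have hpos : 0 < ∑ x, |w x| :=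
    Finset.sum_pos' (fun _ _ => abs_nonneg _) ⟨x₀, Finset.mem_univ _, abs_pos.2 hx₀⟩
  refine ⟨fun x => |w x| / ∑ x, |w x|, ⟨fun x => div_nonneg (abs_nonneg _) hpos.le, ?_⟩, fun y => ?_⟩
  · rw [← Finset.sum_div, div_self hpos.ne']
  · simp_rw [div_mul_eq_mul_div]
    rw [← Finset.sum_div, ← heq y (Finset.mem_univ y)]

/-- `V` vanishes on `A` and decreases in mean by at least `1` at each step from outside `A`. -/
structure IsDrift (P : Chain S) (A : Set S) (V : S → ℝ) : Prop where
  nonneg : ∀ x, 0 ≤ V x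
  eq_zero : ∀ x ∈ A, V x = 0
  step : ∀ x, x ∉ A → ∑ y, P.prob x y * V y + 1 ≤ V x

/-- The expected number of positive times, up to the first entrance into `A` included, at which the
chain started at `x` is at `y`. -/
noncomputable def green (P : Chain S) (A : Set S) (x y : S) : ℝ := ∑' n, P.tabooProb A n x y

theorem green_nonneg (P : Chain S) (A : Set S) (x y : S) : 0 ≤ P.green A x y :=
  tsum_nonneg fun n => P.tabooProb_nonneg A n x y

open scoped Classical

theorem sum_split (A : Set S) [Fintype A] (f : S → ℝ) :
    ∑ x, f x = ∑ a : A, f a + ∑ x with x ∉ A, f x := by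
  rw [← Finset.sum_filter_add_sum_filter_not Finset.univ (· ∈ A),
    Finset.sum_subtype (p := (· ∈ A)) _ (by simp)]

theorem IsStationary.sum_subtype_le_one {P : Chain S} {μ : S → ℝ} (hμ : P.IsStationary μ)
    (A : Set S) [Fintype A] : ∑ a : A, μ a ≤ 1 := by
  rw [← hμ.1.2, sum_split A]
  exact le_add_of_nonneg_right (Finset.sum_nonneg fun x _ => hμ.1.1 x)

namespace IsDrift

variable {P : Chain S} {A : Set S} {V : S → ℝ} [Fintype A]

theorem sum_compl (hV : P.IsDrift A V) (f : S → ℝ) : ∑ x with x ∉ A, f x * V x = ∑ x, f x * V x := by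
  rw [sum_split A fun x => f x * V x, eq_comm, add_eq_right]
  exact Finset.sum_eq_zero fun a _ => by rw [hV.eq_zero a a.2, mul_zero]

/-- Each unit of time spent outside `A` is paid for by a unit drop of `V`; the second sum is the `V`
still unspent at time `N + 1`. -/
theorem sum_tabooProb_le (hV : P.IsDrift A V) (x : S) (N : ℕ) :
    ∑ n ∈ Finset.range N, ∑ z with z ∉ A, P.tabooProb A n x z
      + ∑ z with z ∉ A, P.tabooProb A N x z * V z ≤ ∑ y, P.prob x y * V y := by
  induction N with
  | zero => simp [tabooProb, hV.sum_compl]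
  | succ N ih =>
    refine le_trans ?_ ih
    rw [Finset.sum_range_succ, add_assoc, add_le_add_iff_left]
    have h : ∑ z with z ∉ A, P.tabooProb A (N + 1) x z * V z =
        ∑ w with w ∉ A, P.tabooProb A N x w * ∑ z, P.prob w z * V z := by
      rw [hV.sum_compl]
      simp_rw [tabooProb, Finset.sum_mul, Finset.mul_sum]
      rw [Finset.sum_comm]
      simp_rw [mul_assoc]
    rw [h, ← Finset.sum_add_distrib]
    refine Finset.sum_le_sum fun w hw => ?_
    have := mul_le_mul_of_nonneg_left (hV.step w (Finset.mem_filter.1 hw).2)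
      (P.tabooProb_nonneg A N x w)
    linarith

theorem summable_tabooProb (hV : P.IsDrift A V) (x y : S) :
    Summable fun n => P.tabooProb A n x y := by
  have h : ∀ z, z ∉ A → Summable fun n => P.tabooProb A n x z := fun z hz => by
    refine summable_of_sum_range_le (fun n => P.tabooProb_nonneg A n x z) (fun N => ?_)
      (c := ∑ y, P.prob x y * V y)
    refine le_trans (Finset.sum_le_sum fun n _ => ?_) (le_trans (le_add_of_nonneg_right ?_)
      (hV.sum_tabooProb_le x N))
    · exact Finset.single_le_sum (f := fun z => P.tabooProb A n x z)
        (fun w _ => P.tabooProb_nonneg A n x w) (by simpa using hz)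
    · exact Finset.sum_nonneg fun z _ => mul_nonneg (P.tabooProb_nonneg A N x z) (hV.nonneg z)
  -- The bound only covers states outside `A`; for any `y`, the shifted terms are one step from such
  -- states.
  rw [← summable_nat_add_iff 1]
  exact summable_sum fun z hz => (h z (Finset.mem_filter.1 hz).2).mul_right _

theorem green_eq (hV : P.IsDrift A V) (x y : S) :
    P.green A x y = P.prob x y + ∑ z with z ∉ A, P.green A x z * P.prob z y := by
  rw [green, (hV.summable_tabooProb x y).tsum_eq_zero_add]
  simp only [tabooProb, green]
  rw [Summable.tsum_finsetSum fun z _ => (hV.summable_tabooProb x z).mul_right _]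
  simp_rw [tsum_mul_right]

/-- Almost sure absorption in `A`: summing the last-step equation over all `y`, the finite mass
outside `A` cancels. -/
theorem sum_green (hV : P.IsDrift A V) (x : S) : ∑ a : A, P.green A x a = 1 := by
  have h : ∑ y, P.green A x y = 1 + ∑ z with z ∉ A, P.green A x z := by
    rw [Finset.sum_congr rfl fun y _ => hV.green_eq x y, Finset.sum_add_distrib, P.sum_eq_one,
      Finset.sum_comm]
    simp_rw [← Finset.mul_sum, P.sum_eq_one, mul_one]
  rw [sum_split A] at h
  linarith

/-- The diagonal agrees too, because the rows of the Green function over `A` already sum to `1`. -/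
theorem induced_prob (hV : P.IsDrift A V) (a b : A) :
    (P.induced A).prob a b = P.green A a b := by
  have hF : ∀ c : A, P.firstEntryProb A a c = P.green A a c :=
    fun c => P.firstEntryProb_eq_tsum A a c.2
  simp only [induced, hF]
  split_ifs with hab
  · have h := hV.sum_green a
    rw [sub_eq_iff_eq_add, ← hab, add_comm, Finset.sum_erase_add _ _ (Finset.mem_univ a), ← h]
  · rfl

/-- A signed measure that is invariant under the chain killed on `A` is zero. -/
theorem eq_zero_of_killed (hV : P.IsDrift A V) {w : S → ℝ}
    (hw : ∀ y, w y = ∑ z with z ∉ A, w z * P.prob z y) : w = 0 := by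
  -- `|w|` is subinvariant for the killed chain; pairing it with `V` loses `|w|` outside `A`, which
  -- must vanish.
  have h1 : ∑ y with y ∉ A, |w y| * V y ≤ ∑ z with z ∉ A, |w z| * (V z - 1) := by
    rw [hV.sum_compl]
    calc ∑ y, |w y| * V y ≤ ∑ y, (∑ z with z ∉ A, |w z| * P.prob z y) * V y := by
          refine Finset.sum_le_sum fun y _ => mul_le_mul_of_nonneg_right ?_ (hV.nonneg y)
          conv_lhs => rw [hw y]
          refine (Finset.abs_sum_le_sum_abs _ _).trans (Finset.sum_le_sum fun z _ => ?_)
          rw [abs_mul, abs_of_nonneg (P.nonneg z y)]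
      _ = ∑ z with z ∉ A, |w z| * ∑ y, P.prob z y * V y := by
          simp_rw [Finset.sum_mul, Finset.mul_sum]
          rw [Finset.sum_comm]
          simp_rw [mul_assoc]
      _ ≤ _ := Finset.sum_le_sum fun z hz => mul_le_mul_of_nonneg_left
          (by linarith [hV.step z (Finset.mem_filter.1 hz).2]) (abs_nonneg _)
  simp_rw [mul_sub, mul_one, Finset.sum_sub_distrib] at h1
  have h2 : ∑ z with z ∉ A, |w z| = 0 :=
    le_antisymm (by linarith) (Finset.sum_nonneg fun _ _ => abs_nonneg _)
  have h3 := (Finset.sum_eq_zero_iff_of_nonneg fun z _ => abs_nonneg (w z)).1 h2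
  ext y
  rw [hw y]
  exact Finset.sum_eq_zero fun z hz => by rw [abs_eq_zero.1 (h3 z hz), zero_mul]

/-- The mass outside `A` of a stationary distribution is controlled by the flow out of `A`. -/
theorem sum_compl_le (hV : P.IsDrift A V) {μ : S → ℝ} (hμ : P.IsStationary μ) :
    ∑ z with z ∉ A, μ z ≤ ∑ a : A, μ a * ∑ y, P.prob a y * V y := by
  -- Stationarity tested against `V`.
  have h : ∑ y, μ y * V y = ∑ x, μ x * ∑ y, P.prob x y * V y := by
    rw [Finset.sum_congr rfl fun y _ => congrArg (· * V y) (hμ.2 y).symm]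
    simp_rw [Finset.sum_mul, Finset.mul_sum]
    rw [Finset.sum_comm]
    simp_rw [mul_assoc]
  rw [sum_split A fun x => μ x * ∑ y, P.prob x y * V y, ← hV.sum_compl] at h
  have h' : ∑ z with z ∉ A, μ z * ∑ y, P.prob z y * V y ≤ ∑ z with z ∉ A, (μ z * V z - μ z) :=
    Finset.sum_le_sum fun z hz => by
      have := mul_le_mul_of_nonneg_left (hV.step z (Finset.mem_filter.1 hz).2) (hμ.1.1 z)
      linarith
  rw [Finset.sum_sub_distrib] at h'
  linarith

/-- Since `V` vanishes on `A`, only arcs leaving `A` feed the outside mass, each with weight at most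
`M`. -/
theorem le_sum_exitArcs (hV : P.IsDrift A V) {M : ℝ} (hM : ∀ x, V x ≤ M) {μ : S → ℝ}
    (hμ : P.IsStationary μ) {x : S} (hx : x ∉ A) :
    μ x ≤ M * ∑ i ∈ exitArcs A, P.prob i.1 i.2 := by
  refine (Finset.single_le_sum (f := μ) (fun z _ => hμ.1.1 z)
    (Finset.mem_filter.2 ⟨Finset.mem_univ x, hx⟩)).trans ((hV.sum_compl_le hμ).trans ?_)
  rw [exitArcs, Finset.sum_product, Finset.mul_sum]
  refine Finset.sum_le_sum fun a _ => ?_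
  rw [← hV.sum_compl, Finset.mul_sum, Finset.mul_sum]
  refine Finset.sum_le_sum fun y _ => ?_
  have hμ1 : μ a ≤ 1 := by
    rw [← hμ.1.2]
    exact Finset.single_le_sum (fun y _ => hμ.1.1 y) (Finset.mem_univ _)
  have hP := P.nonneg a y
  calc μ a * (P.prob a y * V y) ≤ 1 * (P.prob a y * M) :=
        mul_le_mul hμ1 (mul_le_mul_of_nonneg_left (hM y) hP)
          (mul_nonneg hP (hV.nonneg y)) zero_le_one
    _ = M * P.prob a y := by ring

theorem one_le_mass (hV : P.IsDrift A V) {M : ℝ} (hM : ∀ x, V x ≤ M) {μ : S → ℝ}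
    (hμ : P.IsStationary μ) : 1 ≤ (1 + M) * ∑ a : A, μ a := by
  have h1 := hμ.1.2
  rw [sum_split A] at h1
  have h2 : ∑ a : A, μ a * ∑ y, P.prob a y * V y ≤ ∑ a : A, μ a * M :=
    Finset.sum_le_sum fun a _ => mul_le_mul_of_nonneg_left
      (calc ∑ y, P.prob a y * V y ≤ ∑ y, P.prob a y * M :=
            Finset.sum_le_sum fun y _ => mul_le_mul_of_nonneg_left (hM y) (P.nonneg a y)
        _ = M := by rw [← Finset.sum_mul, P.sum_eq_one, one_mul]) (hμ.1.1 a)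
  rw [← Finset.sum_mul] at h2
  linarith [hV.sum_compl_le hμ]

/-- The flow balance of `μ`, seen from the visits to `A`. -/
theorem sum_green_of_stationary (hV : P.IsDrift A V) {μ : S → ℝ} (hμ : P.IsStationary μ) (y : S) :
    ∑ a : A, μ a * P.green A a y = μ y := by
  let u : S → ℝ := fun y => ∑ a : A, μ a * P.green A a y
  -- `u` and `μ` solve the same last-step equation with source from `A`, so their difference is
  -- invariant for the killed chain.
  have hw : (fun y => u y - μ y) = 0 := by
    refine hV.eq_zero_of_killed fun y => ?_
    have h1 : u y = ∑ a : A, μ a * P.prob a y + ∑ z with z ∉ A, u z * P.prob z y := by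
      simp only [u]
      simp_rw [fun a : A => hV.green_eq a y, mul_add, Finset.sum_add_distrib, Finset.mul_sum,
        Finset.sum_mul]
      rw [Finset.sum_comm]
      simp_rw [mul_assoc]
    have h2 := hμ.2 y
    rw [sum_split A] at h2
    simp_rw [sub_mul]
    rw [Finset.sum_sub_distrib]
    linarith
  exact sub_eq_zero.1 (congrFun hw y)

theorem isStationary_induced (hV : P.IsDrift A V) {M : ℝ} (hM : ∀ x, V x ≤ M)
    {μ : S → ℝ} (hμ : P.IsStationary μ) :
    (P.induced A).IsStationary fun a => μ a / ∑ b : A, μ b := by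
  have hne : ∑ b : A, μ b ≠ 0 := fun h => by
    have := hV.one_le_mass hM hμ
    rw [h, mul_zero] at this
    linarith
  refine ⟨⟨fun a => div_nonneg (hμ.1.1 a) (Finset.sum_nonneg fun b _ => hμ.1.1 b), ?_⟩, fun b => ?_⟩
  · rw [← Finset.sum_div, div_self hne]
  · simp_rw [hV.induced_prob, div_mul_eq_mul_div]
    rw [← Finset.sum_div, ← hV.sum_green_of_stationary hμ b]

theorem exists_isStationary_extension (hV : P.IsDrift A V) {M : ℝ} (hM : ∀ x, V x ≤ M)
    {ν : A → ℝ} (hν : (P.induced A).IsStationary ν) :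
    ∃ μ, P.IsStationary μ ∧ ∀ a : A, ν a ≤ (1 + M) * μ a := by
  let u : S → ℝ := fun y => ∑ a : A, ν a * P.green A a y
  have hu0 : ∀ y, 0 ≤ u y := fun y =>
    Finset.sum_nonneg fun a _ => mul_nonneg (hν.1.1 a) (P.green_nonneg A a y)
  have huA : ∀ a : A, u a = ν a := fun b => by
    rw [← hν.2 b]
    simp_rw [hV.induced_prob]
    rfl
  have hsA : ∑ a : A, u a = 1 := by
    simp_rw [huA]
    exact hν.1.2
  have hs : 1 ≤ ∑ y, u y := by
    rw [sum_split A, hsA]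
    exact le_add_of_nonneg_right (Finset.sum_nonneg fun _ _ => hu0 _)
  have hst : ∀ y, ∑ x, u x * P.prob x y = u y := fun y => by
    have h1 : u y = ∑ a : A, ν a * P.prob a y + ∑ z with z ∉ A, u z * P.prob z y := by
      simp only [u]
      simp_rw [fun a : A => hV.green_eq a y, mul_add, Finset.sum_add_distrib, Finset.mul_sum,
        Finset.sum_mul]
      congr 1
      rw [Finset.sum_comm]
      simp_rw [mul_assoc]
    rw [h1, sum_split A]
    simp_rw [huA]
  have hμ : P.IsStationary fun x => u x / ∑ y, u y := by
    refine ⟨⟨fun x => div_nonneg (hu0 x) (by linarith), ?_⟩, fun y => ?_⟩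
    · rw [← Finset.sum_div, div_self (by linarith)]
    · simp_rw [div_mul_eq_mul_div]
      rw [← Finset.sum_div, hst]
  refine ⟨_, hμ, fun a => ?_⟩
  -- `u` has mass `1` on `A`, so this says that the normaliser `∑ u` is at most `1 + M`.
  have h := hV.one_le_mass hM hμ
  rw [← Finset.sum_div, hsA] at h
  rw [← huA]
  have := mul_le_mul_of_nonneg_left h (hu0 a)
  calc u a ≤ u a * ((1 + M) * (1 / ∑ y, u y)) := by linarith
    _ = (1 + M) * (u a / ∑ y, u y) := by ring

end IsDrift
end Chain
-- From reachability to a drift function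
/-- A rank function for a target set that every state reaches. -/
theorem exists_rank {S : Type*} {r : S → S → Prop} {A : Set S}
    (h : ∀ x, ∃ y ∈ A, Relation.ReflTransGen r x y) :
    ∃ d : S → ℕ, (∀ x ∈ A, d x = 0) ∧ ∀ x, x ∉ A → ∃ y, r x y ∧ d y < d x := by
  classical
  -- `R n` holds the states with a walk of length `n` into `A`; the rank is the least such `n`.
  let R : ℕ → Set S := Nat.rec (motive := fun _ => Set S) A (fun _ B => {x | ∃ y ∈ B, r x y})
  have hR : ∀ x, ∃ n, x ∈ R n := fun x => by
    obtain ⟨y, hy, hxy⟩ := h x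
    induction hxy using Relation.ReflTransGen.head_induction_on with
    | refl => exact ⟨0, hy⟩
    | head hab _ ih =>
      obtain ⟨n, hn⟩ := ih
      exact ⟨n + 1, _, hn, hab⟩
  refine ⟨fun x => Nat.find (hR x), fun x hx => (Nat.find_eq_zero (hR x)).2 hx, fun x hx => ?_⟩
  obtain ⟨m, hm⟩ := Nat.exists_eq_succ_of_ne_zero
    (fun h0 => hx ((Nat.find_eq_zero (hR x)).1 h0) : Nat.find (hR x) ≠ 0)
  have hs := Nat.find_spec (hR x)
  rw [hm] at hs
  obtain ⟨y, hy, hxy⟩ := hs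
  exact ⟨y, hxy, lt_of_le_of_lt (Nat.find_min' (hR y) hy) (m.lt_succ_self.trans_eq hm.symm)⟩

/-- Every state reaches one from which it is always possible to come back. -/
theorem exists_recurrent {S : Type*} [Finite S] (r : S → S → Prop) (x : S) :
    ∃ y, Relation.ReflTransGen r x y ∧
      ∀ z, Relation.ReflTransGen r y z → Relation.ReflTransGen r z y := by
  let R : S → Set S := fun y => {z | Relation.ReflTransGen r y z}
  -- A reachable state with the fewest reachable states: nothing it reaches can have a smaller
  -- reachable set.
  obtain ⟨y, hy, hmin⟩ := Set.exists_min_image (R x) (fun y => (R y).ncard) (Set.toFinite _)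
    ⟨x, Relation.ReflTransGen.refl⟩
  refine ⟨y, hy, fun z hz => ?_⟩
  have hsub : R z ⊆ R y := fun w hw => hz.trans hw
  have heq := Set.eq_of_subset_of_ncard_le hsub (hmin z (hy.trans hz)) (Set.toFinite _)
  exact heq.ge (Relation.ReflTransGen.refl : y ∈ R y)

/-- With `t = c / 2`, moving to a lower rank `d y` contributes at least `c * t ^ d y = 2 * t ^ (d y
+ 1)` to the mean of `t ^ d`. One copy covers `t ^ d x`, the other covers `t ^ N`, which the
prefactor scales to the unit drop. -/
theorem Chain.isDrift_of_rank {S : Type*} [Fintype S] {P : Chain S} {A : Set S} {d : S → ℕ} {N : ℕ}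
    (hdN : ∀ x, d x ≤ N) (hdA : ∀ x ∈ A, d x = 0) {c : ℝ} (hc0 : 0 < c) (hc1 : c ≤ 1)
    (hstep : ∀ x, x ∉ A → ∃ y, c ≤ P.prob x y ∧ d y < d x) :
    P.IsDrift A fun x => ((c / 2) ^ N)⁻¹ * (1 - (c / 2) ^ d x) := by
  have ht0 : 0 < c / 2 := by linarith
  have ht1 : c / 2 ≤ 1 := by linarith
  refine ⟨fun x => mul_nonneg (by positivity) (sub_nonneg.2 (pow_le_one₀ ht0.le ht1)),
    fun x hx => by simp [hdA x hx], fun x hx => ?_⟩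
  obtain ⟨y, hy, hlt⟩ := hstep x hx
  have h1 : c * (c / 2) ^ d y ≤ ∑ z, P.prob x z * (c / 2) ^ d z :=
    (mul_le_mul_of_nonneg_right hy (by positivity)).trans
      (Finset.single_le_sum (f := fun z => P.prob x z * (c / 2) ^ d z)
        (fun z _ => mul_nonneg (P.nonneg x z) (by positivity)) (Finset.mem_univ y))
  have h2 : (c / 2) ^ d x ≤ (c / 2) ^ (d y + 1) := pow_le_pow_of_le_one ht0.le ht1 hlt
  have h3 : (c / 2) ^ N ≤ (c / 2) ^ (d y + 1) :=
    pow_le_pow_of_le_one ht0.le ht1 (hlt.trans_le (hdN x))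
  have h4 : ∑ z, P.prob x z * (((c / 2) ^ N)⁻¹ * (1 - (c / 2) ^ d z)) =
      ((c / 2) ^ N)⁻¹ * (1 - ∑ z, P.prob x z * (c / 2) ^ d z) := by
    rw [← P.sum_eq_one x, ← Finset.sum_sub_distrib, Finset.mul_sum]
    exact Finset.sum_congr rfl fun z _ => by rw [P.sum_eq_one]; ring
  have h5 : (1 : ℝ) = ((c / 2) ^ N)⁻¹ * (c / 2) ^ N := (inv_mul_cancel₀ (by positivity)).symm
  rw [h4]
  nth_rewrite 2 [h5]
  rw [← mul_add]
  refine mul_le_mul_of_nonneg_left ?_ (by positivity)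
  rw [pow_succ] at h2 h3
  linarith

/-! ### The order `≾` along `ε → 0` -/

section Preceq

variable {I : Set ℝ}

/-- The filter `ε → 0` along `I`. -/
abbrev noiseFilter (I : Set ℝ) : Filter I := comap ((↑) : I → ℝ) (𝓝 0)

theorem IsNoiseSet.neBot (hI : IsNoiseSet I) : (noiseFilter I).NeBot := by
  refine comap_neBot fun t ht => ?_
  obtain ⟨x, hxt, -, hxI⟩ := ((accPt_iff_frequently.1 hI.2).and_eventually ht).exists.imp
    fun x hx => And.intro hx.2 hx.1
  exact ⟨⟨x, hxI⟩, hxt⟩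

theorem IsNoiseSet.eventually_iff (hI : IsNoiseSet I) {Q : I → Prop} :
    (∀ᶠ ε in noiseFilter I, Q ε) ↔ ∃ δ : ℝ, 0 < δ ∧ ∀ ε : I, (ε : ℝ) < δ → Q ε := by
  rw [((Metric.nhds_basis_ball (x := (0 : ℝ))).comap _).eventually_iff]
  refine exists_congr fun δ => and_congr_right fun _ => forall_congr' fun ε => ?_
  simp [abs_of_pos (hI.1 ε ε.2)]

theorem IsNoiseSet.preceq_iff (hI : IsNoiseSet I) {f g : I → ℝ} :
    Preceq f g ↔ ∃ b : ℝ, 0 < b ∧ ∀ᶠ ε in noiseFilter I, f ε ≤ b * g ε := by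
  simp_rw [hI.eventually_iff, Preceq]

/-- A finite sum of functions that are pairwise comparable is dominated by one of them. -/
theorem IsNoiseSet.exists_sum_le (hI : IsNoiseSet I) {ι : Type*} {s : Finset ι} (hs : s.Nonempty)
    {f : ι → I → ℝ} (h : ∀ i ∈ s, ∀ j ∈ s, Preceq (f i) (f j) ∨ Preceq (f j) (f i)) :
    ∃ i ∈ s, ∃ b : ℝ, 0 < b ∧ ∀ᶠ ε in noiseFilter I, ∑ j ∈ s, f j ε ≤ b * f i ε := by
  induction hs using Finset.Nonempty.cons_induction with
  | singleton a => exact ⟨a, by simp, 1, one_pos, by simp⟩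
  | cons a s has _ ih =>
    obtain ⟨i, hi, b, hb, hle⟩ := ih fun i hi j hj =>
      h i (Finset.mem_cons_of_mem hi) j (Finset.mem_cons_of_mem hj)
    rcases h a (Finset.mem_cons_self a s) i (Finset.mem_cons_of_mem hi) with h' | h'
    · obtain ⟨b', hb', hle'⟩ := hI.preceq_iff.1 h'
      refine ⟨i, Finset.mem_cons_of_mem hi, b' + b, by positivity, ?_⟩
      filter_upwards [hle, hle'] with ε h1 h2
      rw [Finset.sum_cons, add_mul]
      exact add_le_add h2 h1
    · obtain ⟨b', hb', hle'⟩ := hI.preceq_iff.1 h'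
      refine ⟨a, Finset.mem_cons_self a s, 1 + b * b', by positivity, ?_⟩
      filter_upwards [hle, hle'] with ε h1 h2
      rw [Finset.sum_cons, add_mul, one_mul, mul_assoc]
      exact add_le_add le_rfl (h1.trans (mul_le_mul_of_nonneg_left h2 hb.le))

end Preceq

/-! ### Stability of perturbations -/

namespace Perturbation

variable {I : Set ℝ} {S : Type*} [Fintype S] {p : Perturbation I S}

/-- Turns the liminf into a uniform lower bound, so that stationary distributions can be handled one
`ε` at a time. -/
theorem isStable_iff (hI : IsNoiseSet I) [Nonempty S] {x : S} :
    p.IsStable x ↔ ∃ c : ℝ, 0 < c ∧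
      ∀ᶠ ε in noiseFilter I, ∃ μ, (p ε).IsStationary μ ∧ c ≤ μ x := by
  classical
  have := hI.neBot
  constructor
  · rintro ⟨μ, hμ, hlim⟩
    obtain ⟨c, hc, hc'⟩ := exists_between hlim
    refine ⟨c, hc, ?_⟩
    have hb : IsBoundedUnder (· ≥ ·) (noiseFilter I) fun ε => μ ε x :=
      isBoundedUnder_of ⟨0, fun ε => (hμ ε).1.1 x⟩
    filter_upwards [eventually_lt_of_lt_liminf hc' hb] with ε hε
    exact ⟨μ ε, hμ ε, hε.le⟩
  · rintro ⟨c, hc, h⟩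
    -- Where the bound fails, any stationary distribution completes the family.
    let μ : I → S → ℝ := fun ε => if h : ∃ μ, (p ε).IsStationary μ ∧ c ≤ μ x then h.choose
      else (p ε).exists_isStationary.choose
    have hμ : ∀ ε, (p ε).IsStationary (μ ε) := fun ε => by
      by_cases h : ∃ μ, (p ε).IsStationary μ ∧ c ≤ μ x
      · simp only [μ, dif_pos h]
        exact h.choose_spec.1
      · simp only [μ, dif_neg h]
        exact (p ε).exists_isStationary.choose_spec
    refine ⟨μ, hμ, hc.trans_le (le_liminf_of_le ?_ ?_)⟩
    · refine IsBoundedUnder.isCoboundedUnder_ge (isBoundedUnder_of ⟨1, fun ε => ?_⟩)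
      rw [← (hμ ε).1.2]
      exact Finset.single_le_sum (fun y _ => (hμ ε).1.1 y) (Finset.mem_univ x)
    · filter_upwards [h] with ε hε
      simp only [μ, dif_pos hε]
      exact hε.choose_spec.2

/-- The row of `x`, diagonal included, sums to `1` and each entry is at most a constant times `p(x,
y)`. -/
theorem EssArc.exists_le (hI : IsNoiseSet I) {x y : S} (h : p.EssArc x y) :
    ∃ c : ℝ, 0 < c ∧ ∀ᶠ ε in noiseFilter I, c ≤ p.map x y ε := by
  choose b hb hle using fun t => hI.preceq_iff.1 (h.2 x t)
  have hpos : 0 < ∑ t, b t := Finset.sum_pos (fun t _ => hb t) ⟨x, Finset.mem_univ x⟩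
  refine ⟨(∑ t, b t)⁻¹, inv_pos.2 hpos, ?_⟩
  filter_upwards [eventually_all.2 hle] with ε hε
  rw [inv_le_iff_one_le_mul₀' hpos, Finset.sum_mul, ← (p ε).sum_eq_one x]
  exact Finset.sum_le_sum fun t _ => hε t

theorem essArc_of_le (hI : IsNoiseSet I) {x y : S} (hxy : x ≠ y) {c : ℝ} (hc : 0 < c)
    (h : ∀ᶠ ε in noiseFilter I, c ≤ p.map x y ε) : p.EssArc x y := by
  refine ⟨hxy, fun z t => hI.preceq_iff.2 ⟨c⁻¹, inv_pos.2 hc, ?_⟩⟩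
  filter_upwards [h] with ε hε
  have h1 : p.map z t ε ≤ 1 := by
    rw [← (p ε).sum_eq_one z]
    exact Finset.single_le_sum (fun w _ => (p ε).nonneg z w) (Finset.mem_univ t)
  rw [inv_mul_eq_div]
  exact h1.trans ((one_le_div hc).2 hε)

theorem exists_uniform_le (hI : IsNoiseSet I) (p : Perturbation I S) : ∃ c : ℝ, 0 < c ∧ c ≤ 1 ∧
    ∀ᶠ ε in noiseFilter I, ∀ x y, p.EssArc x y → c ≤ p.map x y ε := by
  have h : ∀ᶠ c in 𝓝[>] (0 : ℝ), ∀ x y, p.EssArc x y → ∀ᶠ ε in noiseFilter I, c ≤ p.map x y ε := by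
    refine eventually_all.2 fun x => eventually_all.2 fun y => ?_
    by_cases hxy : p.EssArc x y
    · obtain ⟨c, hc, hle⟩ := hxy.exists_le hI
      filter_upwards [Ioc_mem_nhdsGT hc] with c' hc' _
      exact hle.mono fun ε => hc'.2.trans
    · exact Eventually.of_forall fun _ h => absurd h hxy
  obtain ⟨c, hc, h01⟩ := (h.and (Ioc_mem_nhdsGT one_pos)).exists
  exact ⟨c, h01.1, h01.2, eventually_all.2 fun x => eventually_all.2 fun y =>
    eventually_imp_distrib_left.2 (hc x y)⟩

/-- The component of a state from which return is always possible is a sink. -/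
theorem exists_essReach (p : Perturbation I S) (x : S) :
    ∃ y ∈ p.transientStatesᶜ, p.EssReach x y := by
  obtain ⟨y, hxy, hy⟩ := exists_recurrent p.EssArc x
  refine ⟨y, fun h => h ⟨{z | p.EssReach y z ∧ p.EssReach z y}, ⟨⟨y, rfl⟩, ?_⟩,
    Relation.ReflTransGen.refl, Relation.ReflTransGen.refl⟩, hxy⟩
  rintro z ⟨hz, -⟩ w hw
  have h := hz.tail hw
  exact ⟨h, hy w h⟩

/-- `V` and `M` are built from the rank in the essential graph and a uniform bound on its arcs,
hence are independent of `ε`. -/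
theorem exists_isDrift (hI : IsNoiseSet I) (p : Perturbation I S) : ∃ (V : S → ℝ) (M : ℝ), 0 < M ∧
    (∀ x, V x ≤ M) ∧ ∀ᶠ ε in noiseFilter I, (p ε).IsDrift p.transientStatesᶜ V := by
  obtain ⟨d, hdA, hd⟩ := exists_rank p.exists_essReach
  obtain ⟨c, hc0, hc1, hc⟩ := exists_uniform_le hI p
  have ht0 : 0 < c / 2 := by linarith
  refine ⟨fun x => ((c / 2) ^ Finset.univ.sup d)⁻¹ * (1 - (c / 2) ^ d x),
    ((c / 2) ^ Finset.univ.sup d)⁻¹, by positivity, fun x => ?_, ?_⟩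
  · exact mul_le_of_le_one_right (by positivity) (sub_le_self _ (by positivity))
  · filter_upwards [hc] with ε hε
    refine Chain.isDrift_of_rank (fun x => Finset.le_sup (Finset.mem_univ x)) hdA hc0 hc1
      fun x hx => ?_
    obtain ⟨y, hxy, hlt⟩ := hd x hx
    exact ⟨y, hε x y hxy, hlt⟩

theorem not_essArc_of_mem_compl (hs : p.SingletonEssentialClasses) {x : S}
    (hx : x ∈ p.transientStatesᶜ) (y : S) : ¬ p.EssArc x y := by
  obtain ⟨E, hE, hxE⟩ := not_not.1 hx
  intro hxy
  have hyE := hE.2 x hxE y hxy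
  obtain ⟨e, rfl⟩ := hs E hE
  exact hxy.1 (hxE.trans hyE.symm)

theorem TotallyPreordered.preceq_or (hp : p.TotallyPreordered) {x y z t : S} (hxy : x ≠ y)
    (hzt : z ≠ t) : Preceq (p.map x y) (p.map z t) ∨ Preceq (p.map z t) (p.map x y) :=
  hp _ (Subsemigroup.subset_closure ⟨x, y, hxy, rfl⟩) _
    (Subsemigroup.subset_closure ⟨z, t, hzt, rfl⟩)

/-- A transient state is not stable. -/
theorem IsStable.notMem_transientStates (hI : IsNoiseSet I) (hp : p.TotallyPreordered)
    (hs : p.SingletonEssentialClasses) {x : S} (hx : p.IsStable x) : x ∈ p.transientStatesᶜ := by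
  by_contra hxT
  have : Nonempty S := ⟨x⟩
  obtain ⟨c, hc, hμ⟩ := (isStable_iff hI).1 hx
  obtain ⟨V, M, hM0, hM, hV⟩ := exists_isDrift hI p
  have hne : ∀ i ∈ exitArcs p.transientStatesᶜ, (i.1 : S) ≠ i.2 := fun i hi h =>
    mem_exitArcs.1 hi (h ▸ i.1.2)
  have hss : (exitArcs p.transientStatesᶜ).Nonempty := by
    obtain ⟨y, hy, -⟩ := p.exists_essReach x
    exact ⟨(⟨y, hy⟩, x), mem_exitArcs.2 hxT⟩
  obtain ⟨i, hi, b, hb, hle⟩ := hI.exists_sum_le hss (f := fun i => p.map i.1 i.2)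
    fun i hi j hj => hp.preceq_or (hne i hi) (hne j hj)
  -- From `c ≤ μ x ≤ M * ∑ exits ≤ M * b * p(i)`, the dominant exit arc `i` has probability at least
  -- `c / (M * b)`.
  refine not_essArc_of_mem_compl hs i.1.2 i.2
    (essArc_of_le hI (hne i hi) (c := c / (M * b)) (by positivity) ?_)
  filter_upwards [hμ, hV, hle] with ε hμε hVε hleε
  obtain ⟨μ, hμε, hcμ⟩ := hμε
  rw [div_le_iff₀' (by positivity), mul_assoc]
  exact hcμ.trans ((hVε.le_sum_exitArcs hM hμε hxT).trans (mul_le_mul_of_nonneg_left hleε hM0.le))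

theorem isStable_transientDeletion_iff (hI : IsNoiseSet I) (x : p.EssentialStates) :
    p.transientDeletion.IsStable x ↔ p.IsStable x := by
  have : Nonempty S := ⟨x⟩
  have : Nonempty p.EssentialStates := ⟨x⟩
  obtain ⟨V, M, hM0, hM, hV⟩ := exists_isDrift hI p
  rw [isStable_iff hI, isStable_iff hI]
  constructor
  · rintro ⟨c, hc, h⟩
    refine ⟨c / (1 + M), by positivity, ?_⟩
    filter_upwards [h, hV] with ε hε hVε
    obtain ⟨ν, hν, hcν⟩ := hε
    obtain ⟨μ, hμ, hle⟩ := hVε.exists_isStationary_extension hM hν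
    exact ⟨μ, hμ, (div_le_iff₀' (by positivity)).2 (hcν.trans (hle x))⟩
  · rintro ⟨c, hc, h⟩
    refine ⟨c, hc, ?_⟩
    filter_upwards [h, hV] with ε hε hVε
    obtain ⟨μ, hμ, hcμ⟩ := hε
    refine ⟨_, hVε.isStationary_induced hM hμ, hcμ.trans ?_⟩
    have hpos : 0 < ∑ a : p.EssentialStates, μ a :=
      pos_of_mul_pos_right (one_pos.trans_le (hVε.one_le_mass hM hμ)) (by positivity)
    -- Normalising on `A` divides by a mass at most `1`, so the bound `c` is kept.
    exact le_div_self (hμ.1.1 x) hpos (hμ.sum_subtype_le_one _)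

end Perturbation

end PerturbedMC

theorem mainTheorem7 {I : Set ℝ} (hI : PerturbedMC.IsNoiseSet I) {S : Type*} [Fintype S]
    (p : PerturbedMC.Perturbation I S) (hp : p.TotallyPreordered)
    (hs : p.SingletonEssentialClasses) :
    p.stableStates = ((↑) : p.EssentialStates → S) '' p.transientDeletion.stableStates := by
  ext x
  constructor
  · intro hx
    have hxA := PerturbedMC.Perturbation.IsStable.notMem_transientStates hI hp hs hx
    exact ⟨⟨x, hxA⟩, (PerturbedMC.Perturbation.isStable_transientDeletion_iff hI ⟨x, hxA⟩).2 hx, rfl⟩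
  · rintro ⟨x, hx, rfl⟩
    exact (PerturbedMC.Perturbation.isStable_transientDeletion_iff hI x).1 hx
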